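/- Let $n\ge 0$ be an integer. For a linear 2-form $\omega\in\Lambda^2(\mathbb{R}^{2n+1})^*$, let its rank be the rank of the linear map $\mathbb{R}^{2n+1}\to(\mathbb{R}^{2n+1})^*$, $v\mapsto\omega(v,\cdot)$. Let $\Omega(\mathbb{R}^{2n+1})\subset\Lambda^2(\mathbb{R}^{2n+1})^*$ be the set of 2-forms of maximal rank, that is, of rank $2n$, with the topology induced from the finite-dimensional real vector space $\Lambda^2(\mathbb{R}^{2n+1})^*$. Then $\Omega(\mathbb{R}^{2n+1})$ is simply connected: it is non-empty and path connected, and its fundamental group is trivial. -/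

import Mathlib

/-- The space `Λ²(ℝᵏ)*` of linear 2-forms on `ℝᵏ`, with its (unique) topology as a
finite-dimensional real vector space. -/
abbrev LinearTwoForm (k : ℕ) : Type :=
  EuclideanSpace ℝ (Fin k) [⋀^Fin 2]→L[ℝ] ℝ

namespace LinearTwoForm

/-- The rank of a 2-form `ω`: the dimension of the image of `v ↦ ι_v ω = ω(v, ·)`. -/
noncomputable def rank {k : ℕ} (ω : LinearTwoForm k) : ℕ :=
  Module.finrank ℝ (LinearMap.range (ω.curryLeft : EuclideanSpace ℝ (Fin k) →ₗ[ℝ]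
    (EuclideanSpace ℝ (Fin k) [⋀^Fin 1]→L[ℝ] ℝ)))

/-- The space `Ω(ℝᵏ)` of 2-forms of maximal rank on `ℝᵏ`. The rank of a 2-form is even, so the
maximal rank on `ℝᵏ` is the largest even number that is at most `k`: it is `2n` for `k = 2n`
(linear symplectic forms) and for `k = 2n + 1` (linear presymplectic forms). -/
def Omega (k : ℕ) : Set (LinearTwoForm k) :=
  {ω | ω.rank = 2 * (k / 2)}

end LinearTwoForm

open Set Module Topology
open scoped unitInterval

/-! Put `k = 2n + 1`. Ranks are even, so the forms outside `Omega k` have rank `r ≤ k - 3`. Such a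
form is pulled back from the quotient by its kernel, hence lies in one of finitely many polynomial
images of spaces of codimension `(k - r).choose 2 ≥ 3` (`exists_ofReduction_eq`,
`finrank_reduction_add_two_lt`).

Codimension three does not obstruct loops. A loop is first made smooth; the points `p` from which
the cone over it meets the bad set lie in `shadow`s, which cost two more parameters and still have
Hausdorff dimension below that of the ambient space. Some `p` therefore sees the whole loop, which
contracts (`simplyConnectedSpace_of_compl_subset_iUnion_range`). -/

/-- The points `c r + u • (φ z - c r)`, which contain every `p` such that a segment from `p` to a point
of the curve `c` (the end on `c` excluded) meets the range of `φ`. -/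
def shadow {E F : Type*} [AddCommGroup E] [Module ℝ E] (c : ℝ → E) (φ : F → E) : Set E :=
  range fun q : (ℝ × ℝ) × F => c q.1.1 + q.1.2 • (φ q.2 - c q.1.1)

/-! ### General position by Hausdorff dimension. -/

section GeneralPosition

variable {E : Type*} [NormedAddCommGroup E] [NormedSpace ℝ E]
  {ι : Type*} {F : ι → Type*}

/-- The two extra parameters are `r` and `u`; a `C¹` map does not raise the dimension. -/
theorem dimH_shadow_le {F : Type*} [NormedAddCommGroup F] [NormedSpace ℝ F] [FiniteDimensional ℝ F]
    {c : ℝ → E} (hc : ContDiff ℝ 1 c) {φ : F → E} (hφ : ContDiff ℝ 1 φ) :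
    dimH (shadow c φ) ≤ (finrank ℝ F + 2 : ℕ) := by
  have h : ContDiff ℝ 1 fun q : (ℝ × ℝ) × F => c q.1.1 + q.1.2 • (φ q.2 - c q.1.1) := by
    fun_prop
  refine h.dimH_range_le.trans (le_of_eq ?_)
  simp [add_comm]

theorem segment_subset_of_notMem_shadow {U : Set E} {φ : ∀ i, F i → E}
    (hU : Uᶜ ⊆ ⋃ i, range (φ i)) {c : ℝ → E} {p : E} (hp : p ∉ ⋃ i, shadow c (φ i)) {r : ℝ}
    (hr : c r ∈ U) : segment ℝ p (c r) ⊆ U := by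
  rw [segment_symm, segment_eq_image']
  rintro _ ⟨t, -, rfl⟩
  by_contra hmem
  obtain ⟨i, z, hz⟩ := mem_iUnion.1 (hU hmem)
  -- The end `t = 0` is `c r`, which lies in `U`; otherwise the equation can be solved for `p`, with
  -- `u = t⁻¹`.
  have ht : t ≠ 0 := by
    rintro rfl
    simp [hr] at hmem
  refine hp (mem_iUnion.2 ⟨i, ((r, t⁻¹), z), ?_⟩)
  simp [hz, smul_smul, ht]

variable [FiniteDimensional ℝ E] [Countable ι]
  [∀ i, NormedAddCommGroup (F i)] [∀ i, NormedSpace ℝ (F i)] [∀ i, FiniteDimensional ℝ (F i)]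

theorem exists_notMem_iUnion_shadow {φ : ∀ i, F i → E} (hφ : ∀ i, ContDiff ℝ 1 (φ i))
    (hF : ∀ i, finrank ℝ (F i) + 2 < finrank ℝ E) {c : ℝ → E} (hc : ContDiff ℝ 1 c) :
    ∃ p, p ∉ ⋃ i, shadow c (φ i) := by
  rcases isEmpty_or_nonempty ι with hι | ⟨⟨i₀⟩⟩
  · exact ⟨0, by simp⟩
  -- A bound uniform in `i` is needed: a supremum of numbers below `finrank ℝ E` need not stay below
  -- it.
  have hle : dimH (⋃ i, shadow c (φ i)) ≤ (finrank ℝ E - 1 : ℕ) := by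
    rw [dimH_iUnion]
    refine iSup_le fun i => (dimH_shadow_le hc (hφ i)).trans ?_
    have := hF i
    exact_mod_cast (by omega : finrank ℝ (F i) + 2 ≤ finrank ℝ E - 1)
  have hlt : dimH (⋃ i, shadow c (φ i)) < finrank ℝ E := by
    refine hle.trans_lt ?_
    have := hF i₀
    exact_mod_cast (by omega : finrank ℝ E - 1 < finrank ℝ E)
  exact (dense_compl_of_dimH_lt_finrank hlt).nonempty

theorem isPathConnected_of_compl_subset_iUnion_range {U : Set E} {φ : ∀ i, F i → E}
    (hφ : ∀ i, ContDiff ℝ 1 (φ i)) (hF : ∀ i, finrank ℝ (F i) + 2 < finrank ℝ E)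
    (hU : Uᶜ ⊆ ⋃ i, range (φ i)) : IsPathConnected U := by
  rw [isPathConnected_iff]
  constructor
  -- With `u = 1` the shadow of any curve contains `range φ`.
  · obtain ⟨p, hp⟩ := exists_notMem_iUnion_shadow hφ hF (c := fun _ => 0) contDiff_const
    refine ⟨p, ?_⟩
    by_contra hmem
    obtain ⟨i, z, hz⟩ := mem_iUnion.1 (hU hmem)
    exact hp (mem_iUnion.2 ⟨i, ((0, 1), z), by simp [hz]⟩)
  · intro x hx y hy
    -- A point off the shadows of the line through `x` and `y` sees both of them.
    obtain ⟨p, hp⟩ := exists_notMem_iUnion_shadow hφ hF (c := fun r => x + r • (y - x))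
      (by fun_prop)
    have h0 := segment_subset_of_notMem_shadow hU hp (r := 0) (by simpa using hx)
    have h1 := segment_subset_of_notMem_shadow hU hp (r := 1) (by simpa using hy)
    simp only [zero_smul, add_zero, one_smul, add_sub_cancel] at h0 h1
    exact (JoinedIn.of_segment_subset h0).symm.trans (JoinedIn.of_segment_subset h1)

end GeneralPosition

/-! ### Homotopies of paths in a subset of a normed space. -/

section Loops

variable {E : Type*} [NormedAddCommGroup E] [NormedSpace ℝ E]

/-- Two paths in `U` whose corresponding points are joined by segments in `U` are homotopic. -/
theorem Path.Homotopic.of_segment_subset {U : Set E} {x y : U} {p q : Path x y}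
    (h : ∀ t, segment ℝ (p t : E) (q t) ⊆ U) : p.Homotopic q :=
  ⟨{ toFun := fun a => ⟨AffineMap.lineMap (p a.2 : E) (q a.2 : E) (a.1 : ℝ),
        h a.2 (by rw [segment_eq_image_lineMap]; exact ⟨_, a.1.2, rfl⟩)⟩
     continuous_toFun := by
       simp only [AffineMap.lineMap_apply]
       fun_prop
     map_zero_left := by simp
     map_one_left := by simp
     prop' := by
       intro t a ha
       rcases ha with rfl | rfl <;> simp }⟩

/-- The set of points of `U` that see `p` in `U`. -/
theorem starConvex_setOf_segment_subset (p : E) (U : Set E) :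
    StarConvex ℝ p {x | segment ℝ p x ⊆ U} := by
  intro x hx a b ha hb hab
  have hx' : segment ℝ p x ⊆ U := hx
  refine Subset.trans ?_ hx'
  exact (convex_segment p x).segment_subset (left_mem_segment ℝ p x) ⟨a, b, ha, hb, hab, rfl⟩

/-- The loop runs in the star-shaped, hence contractible, set of points that see `p`. -/
theorem Path.Homotopic.refl_of_segment_subset {U : Set E} {x : U} {q : Path x x} {p : E}
    (h : ∀ t, segment ℝ p (q t : E) ⊆ U) : q.Homotopic (Path.refl x) := by
  let S : Set E := {x | segment ℝ p x ⊆ U}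
  have hS : S ⊆ U := fun y hy => hy (right_mem_segment ℝ p y)
  have hx : (x : E) ∈ S := show segment ℝ p x ⊆ U by simpa using h 0
  have : ContractibleSpace S := (starConvex_setOf_segment_subset p U).contractibleSpace ⟨x, hx⟩
  let q' : Path (⟨x, hx⟩ : S) ⟨x, hx⟩ :=
    { toFun := fun t => ⟨q t, h t⟩
      source' := by simp
      target' := by simp }
  have key := (SimplyConnectedSpace.paths_homotopic q' (Path.refl _)).map
    (⟨inclusion hS, continuous_inclusion hS⟩ : C(S, U))
  exact key

/-- Bernstein approximation: every path in an open set is homotopic, in that set, to the restriction of a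
smooth curve. -/
theorem Path.exists_homotopic_contDiff {U : Set E} (hU : IsOpen U) {x y : U} (γ : Path x y) :
    ∃ (q : Path x y) (c : ℝ → E), ContDiff ℝ 1 c ∧ (∀ t : I, c t = q t) ∧ γ.Homotopic q := by
  let g : C(I, E) := ⟨fun t => γ t, by fun_prop⟩
  obtain ⟨ε, hε, hεU⟩ : ∃ ε > 0, ∀ t, Metric.ball (g t) ε ⊆ U := by
    obtain ⟨ε, hε, h⟩ := (isCompact_range g.continuous).exists_thickening_subset_open hU
      (range_subset_iff.2 fun t => (γ t).2)
    exact ⟨ε, hε, fun t => (Metric.ball_subset_thickening (mem_range_self t) ε).trans h⟩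
  have hev := (bernsteinApproximation_uniform g).eventually (Metric.ball_mem_nhds g hε)
  -- For `n = 0` the only node is `0`, and the approximation would miss the endpoint `y`.
  obtain ⟨n, hn, hn0⟩ := (hev.and (Filter.eventually_ne_atTop 0)).exists
  have hclose (t : I) : bernsteinApproximation n g t ∈ Metric.ball (g t) ε :=
    (ContinuousMap.dist_apply_le_dist t).trans_lt hn
  refine ⟨⟨⟨fun t => ⟨bernsteinApproximation n g t, hεU t (hclose t)⟩, by fun_prop⟩, ?_, ?_⟩,
    fun r => ∑ k : Fin (n + 1), ((n.choose k : ℝ) * r ^ (k : ℕ) * (1 - r) ^ (n - k)) •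
      g (bernstein.z k), by fun_prop, fun t => ?_, .of_segment_subset fun t => ?_⟩
  · ext; simp [g]
  · ext; simp [g, hn0]
  · simp [bernsteinApproximation.apply, bernstein_apply]
  · exact ((convex_ball (g t) ε).segment_subset (Metric.mem_ball_self hε) (hclose t)).trans (hεU t)

end Loops

/-- General position: an open set in a finite-dimensional space whose complement is covered by
countably many `C¹` images of spaces of codimension at least three is simply connected. -/
theorem simplyConnectedSpace_of_compl_subset_iUnion_range {E : Type*} [NormedAddCommGroup E]
    [NormedSpace ℝ E] [FiniteDimensional ℝ E] {ι : Type*} [Countable ι] {F : ι → Type*}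
    [∀ i, NormedAddCommGroup (F i)] [∀ i, NormedSpace ℝ (F i)] [∀ i, FiniteDimensional ℝ (F i)]
    {U : Set E} (hUo : IsOpen U) {φ : ∀ i, F i → E} (hφ : ∀ i, ContDiff ℝ 1 (φ i))
    (hF : ∀ i, finrank ℝ (F i) + 2 < finrank ℝ E) (hU : Uᶜ ⊆ ⋃ i, range (φ i)) :
    SimplyConnectedSpace U := by
  rw [simply_connected_iff_loops_nullhomotopic]
  refine ⟨isPathConnected_iff_pathConnectedSpace.1
    (isPathConnected_of_compl_subset_iUnion_range hφ hF hU), fun x γ => ?_⟩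
  obtain ⟨q, c, hc, hcq, hγq⟩ := γ.exists_homotopic_contDiff hUo
  obtain ⟨p, hp⟩ := exists_notMem_iUnion_shadow hφ hF hc
  refine hγq.trans (.refl_of_segment_subset (p := p) fun t => ?_)
  rw [← hcq t]
  exact segment_subset_of_notMem_shadow hU hp (by rw [hcq t]; exact (q t).2)

/-! ### Linear algebra: coordinates on 2-forms and dimension counts. -/

/-- In odd size, `det M = det Mᵀ = -det M`. -/
theorem Matrix.even_card_of_transpose_eq_neg_of_det_ne_zero {n R : Type*} [Fintype n] [DecidableEq n]
    [CommRing R] [IsDomain R] [CharZero R] {M : Matrix n n R} (hM : M.transpose = -M) (hdet : M.det ≠ 0) :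
    Even (Fintype.card n) := by
  by_contra hodd
  have h := M.det_transpose
  rw [hM, Matrix.det_neg, (Nat.not_even_iff_odd.1 hodd).neg_one_pow, neg_one_mul] at h
  exact hdet (self_eq_neg.1 h.symm)

/-- A finite spanning family contains a basis. -/
theorem exists_fin_basis_of_span_eq_top {K V ι : Type*} [Field K] [AddCommGroup V] [Module K V]
    [Finite ι] {v : ι → V} (hv : Submodule.span K (range v) = ⊤) :
    ∃ (f : Fin (finrank K V) → ι) (b : Basis (Fin (finrank K V)) K V), ∀ i, b i = v (f i) := by
  obtain ⟨κ, a, ha, hsp, hli⟩ := exists_linearIndependent' K v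
  have := Finite.of_injective a ha
  have := Fintype.ofFinite κ
  let b := Basis.mk hli (by rw [hsp, hv])
  have e : κ ≃ Fin (finrank K V) := Fintype.equivFinOfCardEq (finrank_eq_card_basis b).symm
  exact ⟨a ∘ e.symm, b.reindex e, fun i => by simp [b]⟩

namespace LinearTwoForm

/-- The basis vector `eᵢ`. -/
noncomputable abbrev e {k : ℕ} (i : Fin k) : EuclideanSpace ℝ (Fin k) := EuclideanSpace.single i 1

variable {k : ℕ}

/-- The elementary 2-form `eⁱ ∧ eʲ`. -/
noncomputable def wedge (i j : Fin k) : LinearTwoForm k :=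
  ContinuousMultilinearMap.alternatization
    ((ContinuousMultilinearMap.mkPiAlgebra ℝ (Fin 2) ℝ).compContinuousLinearMap
      ![EuclideanSpace.proj i, EuclideanSpace.proj j])

theorem wedge_apply (i j : Fin k) (v : Fin 2 → EuclideanSpace ℝ (Fin k)) :
    wedge i j v = v 0 i * v 1 j - v 1 i * v 0 j := by
  have hperm : (Finset.univ : Finset (Equiv.Perm (Fin 2))) = {1, Equiv.swap 0 1} := by decide
  rw [wedge, ContinuousMultilinearMap.alternatization_apply_apply, hperm,
    Finset.sum_pair (by decide)]
  simp [Fin.prod_univ_two, sub_eq_add_neg]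

/-- The 2-form whose coefficients are the skew-symmetrization of a matrix. -/
noncomputable def ofMatrix : (Fin k → Fin k → ℝ) →ₗ[ℝ] LinearTwoForm k where
  -- Each unordered pair occurs twice in the sum; halving makes the coefficients of a form give back
  -- that form.
  toFun B := ∑ i, ∑ j, (B i j / 2) • wedge i j
  map_add' B C := by simp [add_div, add_smul, Finset.sum_add_distrib]
  map_smul' c B := by simp [mul_div_assoc, mul_smul, Finset.smul_sum]

theorem ofMatrix_apply_e (B : Fin k → Fin k → ℝ) (i j : Fin k) :
    ofMatrix B ![e i, e j] = (B i j - B j i) / 2 := by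
  simp only [ofMatrix, LinearMap.coe_mk, AddHom.coe_mk, ContinuousAlternatingMap.sum_apply,
    ContinuousAlternatingMap.smul_apply, wedge_apply]
  simp [mul_sub, Finset.sum_sub_distrib, sub_div]

theorem apply_swap (ω : (EuclideanSpace ℝ (Fin k)) [⋀^Fin 2]→ₗ[ℝ] ℝ)
    (x y : EuclideanSpace ℝ (Fin k)) : ω ![y, x] = -ω ![x, y] := by
  rw [← ω.map_swap ![x, y] (i := 0) (j := 1) (by decide)]
  congr 1
  ext i : 1
  fin_cases i <;> rfl

theorem ext_e {ω ω' : (EuclideanSpace ℝ (Fin k)) [⋀^Fin 2]→ₗ[ℝ] ℝ}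
    (h : ∀ i j, ω ![e i, e j] = ω' ![e i, e j]) : ω = ω' := by
  refine Basis.ext_alternating (EuclideanSpace.basisFun (Fin k) ℝ).toBasis fun v _ => ?_
  convert h (v 0) (v 1) using 2 <;>
  · ext i : 1
    fin_cases i <;> simp

theorem ofMatrix_coeff (ω : (EuclideanSpace ℝ (Fin k)) [⋀^Fin 2]→ₗ[ℝ] ℝ) :
    (ofMatrix fun i j => ω ![e i, e j]).toAlternatingMap = ω := by
  refine ext_e fun i j => ?_
  have := ofMatrix_apply_e (fun i j => ω ![e i, e j]) i j
  rw [ContinuousAlternatingMap.coe_toAlternatingMap, this, apply_swap ω (e i) (e j)]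
  ring

/-- Over a finite-dimensional space every alternating 2-form is continuous. -/
noncomputable def equivAlternatingMap :
    LinearTwoForm k ≃ₗ[ℝ] (EuclideanSpace ℝ (Fin k)) [⋀^Fin 2]→ₗ[ℝ] ℝ :=
  LinearEquiv.ofBijective (ContinuousAlternatingMap.toAlternatingMapLinear (R := ℝ))
    ⟨ContinuousAlternatingMap.toAlternatingMap_injective, fun ω => ⟨_, ofMatrix_coeff ω⟩⟩

noncomputable def equivDual :
    LinearTwoForm k ≃ₗ[ℝ] Dual ℝ (⋀[ℝ]^2 (EuclideanSpace ℝ (Fin k))) :=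
  equivAlternatingMap.trans exteriorPower.alternatingMapLinearEquiv

instance : FiniteDimensional ℝ (LinearTwoForm k) := equivDual.symm.finiteDimensional

theorem finrank_eq : finrank ℝ (LinearTwoForm k) = k.choose 2 := by
  rw [equivDual.finrank_eq, Subspace.dual_finrank_eq, exteriorPower.finrank_eq,
    finrank_euclideanSpace_fin]

theorem mem_ker_curryLeft {ω : LinearTwoForm k} {x : EuclideanSpace ℝ (Fin k)} :
    x ∈ LinearMap.ker (ω.curryLeft : EuclideanSpace ℝ (Fin k) →ₗ[ℝ]
      (EuclideanSpace ℝ (Fin k) [⋀^Fin 1]→L[ℝ] ℝ)) ↔ ∀ y, ω ![x, y] = 0 := by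
  rw [LinearMap.mem_ker]
  constructor
  · intro h y
    exact DFunLike.congr_fun h ![y]
  · intro h
    ext v
    have : v = ![v 0] := by ext i : 1; fin_cases i; rfl
    rw [this]
    exact h (v 0)

end LinearTwoForm

/-- With `r.choose 2 + s * r` parameters for the forms of rank `r` on `ℝ^(r + s)`, the codimension
is `s.choose 2`. -/
theorem Nat.add_choose_two (r s : ℕ) : (r + s).choose 2 = r.choose 2 + s * r + s.choose 2 := by
  induction s with
  | zero => simp
  | succ s ih =>
    have h (m : ℕ) : (m + 1).choose 2 = m + m.choose 2 := by
      rw [Nat.choose_succ_succ' m 1, Nat.choose_one_right]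
    rw [← add_assoc, h, h, ih]
    ring

/-! ### Kernel and rank of a 2-form. -/

namespace LinearTwoForm

variable {k : ℕ}

/-- A 2-form as a bilinear form. -/
noncomputable def bilin (ω : LinearTwoForm k) :
    EuclideanSpace ℝ (Fin k) →ₗ[ℝ] EuclideanSpace ℝ (Fin k) →ₗ[ℝ] ℝ :=
  LinearMap.mk₂ ℝ (fun x y => ω ![x, y])
    (fun x x' y => DFunLike.congr_fun (ω.curryLeft.map_add x x') ![y])
    (fun c x y => DFunLike.congr_fun (ω.curryLeft.map_smul c x) ![y])
    (fun x y y' => by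
      have h := DFunLike.congr_fun (ω.curryLeft.map_add y y') ![x]
      have := apply_swap ω.toAlternatingMap
      simp only [ContinuousAlternatingMap.coe_toAlternatingMap] at this
      rw [this (y + y') x, this y x, this y' x, ← neg_add]
      exact congrArg Neg.neg h)
    (fun c x y => by
      have h := DFunLike.congr_fun (ω.curryLeft.map_smul c y) ![x]
      have := apply_swap ω.toAlternatingMap
      simp only [ContinuousAlternatingMap.coe_toAlternatingMap] at this
      rw [this (c • y) x, this y x, smul_neg]
      exact congrArg Neg.neg h)

theorem bilin_apply (ω : LinearTwoForm k) (x y : EuclideanSpace ℝ (Fin k)) :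
    ω.bilin x y = ω ![x, y] := rfl

theorem bilin_swap (ω : LinearTwoForm k) (x y : EuclideanSpace ℝ (Fin k)) :
    ω.bilin y x = -ω.bilin x y :=
  apply_swap ω.toAlternatingMap x y

theorem ker_curryLeft (ω : LinearTwoForm k) :
    LinearMap.ker (ω.curryLeft : EuclideanSpace ℝ (Fin k) →ₗ[ℝ]
      (EuclideanSpace ℝ (Fin k) [⋀^Fin 1]→L[ℝ] ℝ)) = LinearMap.ker ω.bilin := by
  ext x
  rw [mem_ker_curryLeft, LinearMap.mem_ker]
  exact ⟨fun h => LinearMap.ext h, fun h y => DFunLike.congr_fun h y⟩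

theorem finrank_quotient_ker (ω : LinearTwoForm k) :
    finrank ℝ (EuclideanSpace ℝ (Fin k) ⧸ LinearMap.ker ω.bilin) = ω.rank := by
  rw [← ker_curryLeft, rank]
  exact (LinearMap.quotKerEquivRange _).finrank_eq

/-- Some `rank ω` of the coordinate vectors form a basis of a complement of the kernel of `ω`. -/
theorem exists_reduction (ω : LinearTwoForm k) :
    ∃ (f : Fin ω.rank → Fin k) (C : Fin k → Fin ω.rank → ℝ), Function.Injective f ∧
      (∀ i i', C (f i) i' = if i' = i then 1 else 0) ∧
      (∀ j, e j - ∑ i, C j i • e (f i) ∈ LinearMap.ker ω.bilin) ∧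
      (∀ c : Fin ω.rank → ℝ, ∑ i, c i • e (f i) ∈ LinearMap.ker ω.bilin → c = 0) := by
  have hspan : Submodule.span ℝ (range fun i : Fin k => (LinearMap.ker ω.bilin).mkQ (e i)) = ⊤ := by
    have h := (EuclideanSpace.basisFun (Fin k) ℝ).toBasis.span_eq
    have h' : (range fun i : Fin k => (LinearMap.ker ω.bilin).mkQ (e i)) =
        (LinearMap.ker ω.bilin).mkQ '' range (EuclideanSpace.basisFun (Fin k) ℝ).toBasis := by
      rw [← range_comp]
      congr 1
      ext i : 1
      simp
    rw [h', ← Submodule.map_span, h, Submodule.map_top, Submodule.range_mkQ]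
  have hbasis := exists_fin_basis_of_span_eq_top hspan
  rw [ω.finrank_quotient_ker] at hbasis
  obtain ⟨f, b, hb⟩ := hbasis
  have hmk (c : Fin ω.rank → ℝ) :
      (LinearMap.ker ω.bilin).mkQ (∑ i, c i • e (f i)) = ∑ i, c i • b i := by
    simp only [map_sum, map_smul, hb]
  have hf : Function.Injective f := fun i j hij => b.injective (by rw [hb, hb, hij])
  refine ⟨f, fun j i => b.repr ((LinearMap.ker ω.bilin).mkQ (e j)) i, hf, fun i i' => ?_,
    fun j => ?_, fun c hc => ?_⟩
  · dsimp only
    rw [← hb, b.repr_self, Finsupp.single_apply]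
    simp only [eq_comm]
  · rw [← Submodule.Quotient.mk_eq_zero, ← Submodule.mkQ_apply, map_sub, hmk, b.sum_repr, sub_self]
  · rw [← Submodule.Quotient.mk_eq_zero, ← Submodule.mkQ_apply, hmk] at hc
    exact funext fun i => Fintype.linearIndependent_iff.1 b.linearIndependent c hc i

/-- The Gram matrix of `ω` on a complement of its kernel is skew-symmetric and nonsingular: a null
vector would give a kernel element inside the complement. -/
theorem even_rank (ω : LinearTwoForm k) : Even ω.rank := by
  obtain ⟨f, C, -, -, hred, hind⟩ := ω.exists_reduction
  let M : Matrix (Fin ω.rank) (Fin ω.rank) ℝ := .of fun i j => ω.bilin (e (f i)) (e (f j))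
  have hM : M.transpose = -M := by
    ext i j
    exact ω.bilin_swap _ _
  suffices M.det ≠ 0 by
    simpa using Matrix.even_card_of_transpose_eq_neg_of_det_ne_zero hM this
  intro hdet
  obtain ⟨c, hc0, hc⟩ := Matrix.exists_vecMul_eq_zero_iff.2 hdet
  refine hc0 (hind c ?_)
  obtain ⟨x, hxc⟩ : ∃ x, x = ∑ i, c i • e (f i) := ⟨_, rfl⟩
  have hx (i) : ω.bilin x (e (f i)) = 0 := by
    have := congrFun hc i
    simpa [hxc, Matrix.vecMul, dotProduct, M] using this
  rw [← hxc, LinearMap.mem_ker]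
  refine (EuclideanSpace.basisFun (Fin k) ℝ).toBasis.ext fun j => ?_
  have h0 : ω.bilin x (e j - ∑ i, C j i • e (f i)) = 0 := by
    rw [ω.bilin_swap, LinearMap.mem_ker.1 (hred j)]
    simp
  rw [map_sub, map_sum, sub_eq_zero] at h0
  simpa [hx] using h0

theorem rank_le (ω : LinearTwoForm k) : ω.rank ≤ k := by
  obtain ⟨f, -, hf, -⟩ := ω.exists_reduction
  simpa using Fintype.card_le_of_injective f hf

/-- Turns maximal rank into a lower bound, which is an open condition. -/
theorem mem_Omega_iff {ω : LinearTwoForm k} : ω ∈ Omega k ↔ 2 * (k / 2) ≤ ω.rank := by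
  obtain ⟨m, hm⟩ := ω.even_rank
  have := ω.rank_le
  exact ⟨fun h => (show ω.rank = _ from h).ge, fun h => (show ω.rank = _ by omega)⟩

theorem isOpen_Omega : IsOpen (Omega k) := by
  have h := (isOpen_setOfPred_nat_le_rank (𝕜 := ℝ) (E := EuclideanSpace ℝ (Fin k))
    (F := EuclideanSpace ℝ (Fin k) [⋀^Fin 1]→L[ℝ] ℝ) (2 * (k / 2))).preimage
      ContinuousAlternatingMap.curryLeftLI.continuous
  refine (congrArg IsOpen (Set.ext fun ω => ?_)).mpr h
  rw [mem_Omega_iff, rank, mem_preimage, mem_ofPred_eq, LinearMap.rank, ← finrank_eq_rank,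
    Nat.cast_le]
  rfl

/-! ### Parametrization of the forms of low rank. -/

section Reduction

variable {r : ℕ} (f : Fin r → Fin k)

open Classical in
/-- Coefficients of all coordinate vectors in terms of those with index in the range of `f`, given the
coefficients of the other ones. -/
noncomputable def extendCoeff (C : {j // j ∉ range f} → Fin r → ℝ) (j : Fin k) (i : Fin r) : ℝ :=
  if h : j ∈ range f then if f i = j then 1 else 0 else C ⟨j, h⟩ i

/-- The 2-forms of rank at most `r` that are determined by their values on the coordinate vectors
with index in the range of `f`. -/
noncomputable def ofReduction (q : LinearTwoForm r × ({j // j ∉ range f} → Fin r → ℝ)) :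
    LinearTwoForm k :=
  ofMatrix fun j l => ∑ i, ∑ i', extendCoeff f q.2 j i * extendCoeff f q.2 l i' * q.1 ![e i, e i']

theorem contDiff_ofReduction : ContDiff ℝ 1 (ofReduction f) := by
  refine (LinearMap.toContinuousLinearMap (ofMatrix (k := k))).contDiff.comp ?_
  have hC (j : Fin k) (i : Fin r) : ContDiff ℝ 1
      fun q : LinearTwoForm r × ({j // j ∉ range f} → Fin r → ℝ) => extendCoeff f q.2 j i := by
    unfold extendCoeff
    split_ifs <;> fun_prop
  have hA (i i' : Fin r) : ContDiff ℝ 1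
      fun q : LinearTwoForm r × ({j // j ∉ range f} → Fin r → ℝ) => q.1 ![e i, e i'] := by
    let L : LinearTwoForm r →ₗ[ℝ] ℝ :=
      { toFun := fun A => A ![e i, e i'], map_add' := fun _ _ => rfl, map_smul' := fun _ _ => rfl }
    exact (LinearMap.toContinuousLinearMap L).contDiff.comp contDiff_fst
  fun_prop

theorem finrank_reduction_add_two_lt (hf : Function.Injective f) (hr : r + 3 ≤ k) :
    finrank ℝ (LinearTwoForm r × ({j // j ∉ range f} → Fin r → ℝ)) + 2 <
      finrank ℝ (LinearTwoForm k) := by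
  obtain ⟨s, rfl⟩ := Nat.exists_eq_add_of_le (show r ≤ k by omega)
  have hcard : Nat.card {j // j ∉ range f} = s := by
    have h := Nat.card_congr (Equiv.Set.sumCompl (range f))
    rw [Nat.card_sum, Nat.card_range_of_injective hf, Nat.card_fin, Nat.card_fin] at h
    exact Nat.add_left_cancel h
  -- Here `s = k - r ≥ 3`, so the codimension is at least three.
  have hs : Nat.choose 3 2 ≤ s.choose 2 := Nat.choose_le_choose 2 (by omega)
  have h3 : Nat.choose 3 2 = 3 := by decide
  have hfun : finrank ℝ ({j // j ∉ range f} → Fin r → ℝ) = s * r := by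
    rw [finrank_pi_fintype, Finset.sum_const, finrank_fin_fun, Finset.card_univ,
      ← Nat.card_eq_fintype_card, hcard, smul_eq_mul]
  rw [finrank_prod, finrank_eq, finrank_eq, hfun, Nat.add_choose_two]
  omega

end Reduction

/-- Modulo the kernel each `e j` is a combination of the `e (f i)`, so the Gram matrix on these and
the coefficients `C` recover `ω`. -/
theorem exists_ofReduction_eq (ω : LinearTwoForm k) :
    ∃ f : Fin ω.rank → Fin k, Function.Injective f ∧ ω ∈ range (ofReduction f) := by
  obtain ⟨f, C, hf, hCf, hred, -⟩ := ω.exists_reduction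
  refine ⟨f, hf, (ofMatrix fun i i' => ω ![e (f i), e (f i')], fun j => C j), ?_⟩
  have hC (j i) : extendCoeff f (fun j : {j // j ∉ range f} => C j) j i = C j i := by
    unfold extendCoeff
    split_ifs with h h'
    · rw [← h', hCf, if_pos rfl]
    · obtain ⟨i', rfl⟩ := h
      rw [hCf, if_neg fun hi => h' (by rw [hi])]
    · rfl
  have hA (i i') : ofMatrix (fun i i' => ω ![e (f i), e (f i')]) ![e i, e i'] =
      ω.bilin (e (f i)) (e (f i')) := by
    rw [ofMatrix_apply_e, ← bilin_apply, ← bilin_apply, ω.bilin_swap (e (f i)) (e (f i'))]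
    ring
  have hω (j l) : ω ![e j, e l] = ∑ i, ∑ i', C j i * C l i' * ω.bilin (e (f i)) (e (f i')) := by
    have h1 : ω.bilin (e j) = ω.bilin (∑ i, C j i • e (f i)) := by
      rw [← sub_eq_zero, ← map_sub, LinearMap.mem_ker.1 (hred j)]
    have h2 (x) : ω.bilin x (e l) = ω.bilin x (∑ i, C l i • e (f i)) := by
      rw [← sub_eq_zero, ← map_sub, ω.bilin_swap, LinearMap.mem_ker.1 (hred l)]
      simp
    rw [← bilin_apply, h2, h1]
    simp only [map_sum, map_smul, LinearMap.sum_apply, LinearMap.smul_apply, smul_eq_mul,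
      Finset.mul_sum]
    rw [Finset.sum_comm]
    exact Finset.sum_congr rfl fun i _ => Finset.sum_congr rfl fun i' _ => by ring
  refine ContinuousAlternatingMap.toAlternatingMap_injective ?_
  rw [← ofMatrix_coeff ω.toAlternatingMap, ofReduction]
  simp only [hC, hA, ContinuousAlternatingMap.coe_toAlternatingMap]
  simp only [hω]

end LinearTwoForm

open LinearTwoForm in
theorem mainTheorem11 (n : ℕ) :
    SimplyConnectedSpace (LinearTwoForm.Omega (2 * n + 1)) := by
  let ι := {x : Σ r : ℕ, Fin r → Fin (2 * n + 1) // x.1 + 3 ≤ 2 * n + 1 ∧ Function.Injective x.2}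
  refine simplyConnectedSpace_of_compl_subset_iUnion_range (ι := ι) isOpen_Omega
    (fun x => contDiff_ofReduction x.1.2)
    (fun x => finrank_reduction_add_two_lt x.1.2 x.2.2 x.2.1) fun ω hω => ?_
  obtain ⟨f, hf, hωf⟩ := ω.exists_ofReduction_eq
  rw [mem_compl_iff, mem_Omega_iff] at hω
  obtain ⟨m, hm⟩ := ω.even_rank
  -- An even rank below `2 * n` is at most `2 * n - 2`, three less than `2 * n + 1`.
  exact mem_iUnion.2 ⟨⟨⟨ω.rank, f⟩, by dsimp only; omega, hf⟩, hωf⟩
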